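/- Let $1_S\in\mathbb R^d$ be the indicator vector of $S\subseteq[d]=\{1,\dots,d\}$, and for $0\le k\le d$ and $\mu\in\mathbb R$ consider the $k$-sets family $\mathcal V_{d,k,\mu}=\{\mu 1_S : S\subseteq[d],\ |S|=k\}$. An estimator is a measurable map $T$ from $\mathbb R^d$ to the set of $k$-subsets of $[d]$. In the isotropic setting $\mathbb P_S=\mathcal N(\mu 1_S,I_d)$ and the minimax risk is $\mathcal R(\mathcal V)=\inf_T\sup_S\mathbb P_S[T(y)\ne S]$. In the experimental design setting, for $B\in\mathbb R_{\ge0}^d$ let $\mathbb P_{S,B}$ be the law of a vector $y$ with independent coordinates, $y(i)\sim\mathcal N(\mu 1_S(i),B(i)^{-1})$ if $B(i)>0$ and $y(i)=0$ almost surely if $B(i)=0$; the minimax risk with budget $\tau$ is $\mathcal R(\mathcal V,\tau)=\inf_{T,\,B:\|B\|_1\le\tau}\sup_S\mathbb P_{S,B}[T(y)\ne S]$. A maximum likelihood estimator (MLE) is any measurable selection of $\arg\min_S\|\mu1_S-y\|_2^2$, respectively, under strategy $B$, of $\arg\min_S\sum_iB(i)(\mu1_S(i)-y(i))^2$; such selections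 exist. For a sequence of problems, "the minimax rate is $\mu\asymp f(n)$" means: for every sequence $\mu_n$, if $f(n)=o(\mu_n)$ then the minimax risk of the $n$-th problem at $\mu=\mu_n$ tends to $0$, and if $\mu_n=o(f(n))$ then it tends to $1$. 1. Let $d_n\to\infty$ and $1\le k_n<d_n$. The minimax rate of $\mathcal R(\mathcal V_{d_n,k_n,\mu})$ is $\mu\asymp\sqrt{\log(k_n(d_n-k_n))}$. 2. For every sequence of budgets $\tau_n>0$, the minimax rate of $\mathcal R(\mathcal V_{d_n,k_n,\mu},\tau_n)$ is $\mu\asymp\sqrt{\tfrac{d_n}{\tau_n}\log(k_n(d_n-k_n))}$. Uniform sampling $\hat B(i)=\tau/d$ is optimal in the following two senses. (a) If $\sqrt{\tfrac{d_n}{\tau_n}\log(k_n(d_n-k_n))}=o(\mu_n)$, then the maximum risk of every MLE under uniform sampling with budget $\tau_n$ tends to $0$. (b) For all $0\le k\le d$, $\mu\in\mathbb R$, $\alpha>0$ and $\tau\ge0$, uniform sampling minimizes $$W(\mathcal V,\alpha,B)=\max_S\sum_{S'\ne S}\exp\Bigl(-\tfrac1\alpha\sum_iB(i)\,\mu^2(1_S(i)-1_{S'}(i))^2\Bigr)$$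 over all $B\in\mathbb R_{\ge0}^d$ with $\|B\|_1\le\tau$. 3. In the isotropic setting, for all $0\le k\le d$ and $\mu\ne0$, every MLE $T$ is exactly minimax optimal: $\sup_S\mathbb P_S[T(y)\ne S]=\mathcal R(\mathcal V_{d,k,\mu})$. -/

import Mathlib

open MeasureTheory ProbabilityTheory Filter Topology Asymptotics
open scoped NNReal ENNReal

namespace NormalMeans

noncomputable section

/-- The law `N(v, I_d)` of an isotropic Gaussian vector with mean `v`. -/
def isoLaw {d : ℕ} (v : Fin d → ℝ) : Measure (Fin d → ℝ) :=
  Measure.pi fun i => gaussianReal (v i) 1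

/-- The law of the observation under the sensing strategy `B`: independent coordinates,
`y i ∼ N(v i, (B i)⁻¹)` if `B i > 0`, and `y i = 0` almost surely if `B i = 0`. -/
def designLaw {d : ℕ} (v : Fin d → ℝ) (B : Fin d → ℝ≥0) : Measure (Fin d → ℝ) :=
  Measure.pi fun i => if B i = 0 then Measure.dirac 0 else gaussianReal (v i) (B i)⁻¹

/-- An estimator is a measurable map into the (discrete) set of hypotheses. -/
def IsEstimator {d : ℕ} {ι : Type} (T : (Fin d → ℝ) → ι) : Prop :=
  @Measurable _ _ _ ⊤ T

/-- The maximum risk `sup_j P_j[T(y) ≠ j]`. -/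
def maxRisk {d : ℕ} {ι : Type} (P : ι → Measure (Fin d → ℝ)) (T : (Fin d → ℝ) → ι) : ℝ≥0∞ :=
  ⨆ j, P j {y | T y ≠ j}

/-- The minimax risk `inf_T sup_j P_j[T(y) ≠ j]` of a family of laws. -/
def lawMinimaxRisk {d : ℕ} {ι : Type} (P : ι → Measure (Fin d → ℝ)) : ℝ≥0∞ :=
  ⨅ (T : (Fin d → ℝ) → ι) (_ : IsEstimator T), maxRisk P T

/-- The minimax risk in the isotropic setting. -/
def minimaxRisk {d : ℕ} {ι : Type} (v : ι → Fin d → ℝ) : ℝ≥0∞ :=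
  lawMinimaxRisk fun j => isoLaw (v j)

/-- The minimax risk in the experimental design setting with budget `τ`: the infimum is over
the estimator and over all strategies `B ≥ 0` with `‖B‖₁ ≤ τ`. -/
def budgetMinimaxRisk {d : ℕ} {ι : Type} (v : ι → Fin d → ℝ) (τ : ℝ≥0) : ℝ≥0∞ :=
  ⨅ (B : Fin d → ℝ≥0) (_ : ∑ i, B i ≤ τ), lawMinimaxRisk fun j => designLaw (v j) B

/-- `T` is a maximum likelihood estimator in the isotropic setting, i.e. a measurable selection
of `argmin_j ‖v_j - y‖₂²` (with any rule for breaking ties). -/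
def IsMLE {d : ℕ} {ι : Type} (v : ι → Fin d → ℝ) (T : (Fin d → ℝ) → ι) : Prop :=
  IsEstimator T ∧ ∀ y j, ∑ i, (v (T y) i - y i) ^ 2 ≤ ∑ i, (v j i - y i) ^ 2

/-- `T` is a maximum likelihood estimator under the strategy `B`, i.e. a measurable selection
of `argmin_j ‖v_j - y‖_B²`. -/
def IsDesignMLE {d : ℕ} {ι : Type} (v : ι → Fin d → ℝ) (B : Fin d → ℝ≥0)
    (T : (Fin d → ℝ) → ι) : Prop :=
  IsEstimator T ∧
    ∀ y j, ∑ i, (B i : ℝ) * (v (T y) i - y i) ^ 2 ≤ ∑ i, (B i : ℝ) * (v j i - y i) ^ 2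

/-- The sampling exponentiated distance function
`W(V, α, B) = max_j ∑_{l ≠ j} exp(-‖v_j - v_l‖_B² / α)`. -/
def sedf {d : ℕ} {ι : Type} [Fintype ι] [DecidableEq ι] (v : ι → Fin d → ℝ) (α : ℝ)
    (B : Fin d → ℝ≥0) : ℝ :=
  ⨆ j, ∑ l with l ≠ j, Real.exp (-(∑ i, (B i : ℝ) * (v j i - v l i) ^ 2) / α)

/-- The uniform sampling strategy with budget `τ`. -/
def uniformDesign (d : ℕ) (τ : ℝ≥0) : Fin d → ℝ≥0 := fun _ => τ / d

/-- The `k`-subsets of `{1, …, d}`. -/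
abbrev KSubset (d k : ℕ) : Type := {S : Finset (Fin d) // S.card = k}

/-- The `k`-sets family: the vectors `μ 1_S` with `|S| = k`. -/
def kSets (d k : ℕ) (μ : ℝ) (S : KSubset d k) : Fin d → ℝ :=
  fun i => if i ∈ S.1 then μ else 0

/-- `μ ≍ f(n)` is the minimax rate for a sequence of problems with risks `R n μ`: if
`μ = ω(1) f(n)` then the risk tends to zero, and if `μ = o(1) f(n)` then it tends to one. -/
def IsMinimaxRate (R : ℕ → ℝ → ℝ≥0∞) (f : ℕ → ℝ) : Prop :=
  ∀ μ : ℕ → ℝ,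
    (f =o[atTop] μ → Tendsto (fun n => R n (μ n)) atTop (𝓝 0)) ∧
    (μ =o[atTop] f → Tendsto (fun n => R n (μ n)) atTop (𝓝 1))

end

end NormalMeans

/-! Everything rests on the likelihood ratio between two means that differ by `u`. It has mean one,
and its second moment is `exp (∑ B i * u i ^ 2)`.

Upper bound on the risk: under uniform sampling the squared error splits over coordinates. The MLE
therefore errs only if some coordinate deviates by `|μ| / 2` in the harmful direction, and Chernoff
with a union bound gives `d * exp (-b * μ ^ 2 / 8)` (`maxRisk_designMLE_le`).

Lower bound: a budget `τ` leaves at least 3/4 of the coordinates with effort at most `4τ/d`. Adding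
or removing one element of a fixed set yields at least `d/4` hypotheses, each a one-coordinate shift
of a common reference mean. Under the reference law the events of choosing each of them are
disjoint, so their total mass is at most one. Truncating the likelihood ratio transfers this to the
hypotheses themselves (`le_maxRisk_of_single_shifts`). As `d / 2 ≤ k * (d - k) ≤ d ^ 2`, both bounds
live on the scale of `log d`.

The exact statements use symmetry under coordinate permutations. Averaging a design over
permutations and applying Jensen to `exp` gives `sedf_uniformDesign_le`. The isotropic MLE is Bayes
for the uniform prior and has the same risk at every `S`, hence is minimax. -/

namespace NormalMeans

/-! ### Likelihood ratios and their moments -/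

section Density

/-- A product of probability measures with densities has the product density. -/
theorem pi_withDensity {ι : Type*} [Fintype ι] {X : ι → Type*} [∀ i, MeasurableSpace (X i)]
    (μ : ∀ i, Measure (X i)) [∀ i, IsProbabilityMeasure (μ i)] {f : ∀ i, X i → ℝ≥0∞}
    (hf : ∀ i, Measurable (f i)) [∀ i, SigmaFinite ((μ i).withDensity (f i))] :
    Measure.pi (fun i => (μ i).withDensity (f i)) =
      (Measure.pi μ).withDensity fun x => ∏ i, f i (x i) := by
  refine Measure.pi_eq fun s hs => ?_
  have hind : iIndepFun (fun i (x : ∀ i, X i) => (s i).indicator (f i) (x i)) (Measure.pi μ) :=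
    iIndepFun_pi (X := fun i => (s i).indicator (f i))
      fun i => ((hf i).indicator (hs i)).aemeasurable
  rw [withDensity_apply _ (MeasurableSet.univ_pi hs),
    ← lintegral_indicator (MeasurableSet.univ_pi hs)]
  have h1 : (Set.univ.pi s).indicator (fun x : ∀ i, X i => ∏ i, f i (x i)) =
      fun x => ∏ i, (s i).indicator (f i) (x i) := by
    funext x
    by_cases hx : x ∈ Set.univ.pi s
    · rw [Set.indicator_of_mem hx]
      exact Finset.prod_congr rfl fun i _ =>
        (Set.indicator_of_mem (hx i (Set.mem_univ i)) _).symm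
    · rw [Set.indicator_of_notMem hx]
      simp only [Set.mem_univ_pi, not_forall] at hx
      obtain ⟨i, hi⟩ := hx
      exact (Finset.prod_eq_zero (Finset.mem_univ i) (Set.indicator_of_notMem hi _)).symm
  rw [h1, lintegral_prod_eq_prod_lintegral_of_indepFun Finset.univ
    (fun i (x : ∀ i, X i) => (s i).indicator (f i) (x i)) hind
    fun i => ((hf i).indicator (hs i)).comp (measurable_pi_apply i)]
  refine Finset.prod_congr rfl fun i _ => ?_
  rw [withDensity_apply _ (hs i), ← lintegral_indicator (hs i),
    ← (measurePreserving_eval μ i).lintegral_comp ((hf i).indicator (hs i))]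

/-- The law of one coordinate of the observation, with sampling effort `b`. -/
noncomputable def coordLaw (m : ℝ) (b : ℝ≥0) : Measure ℝ :=
  if b = 0 then Measure.dirac 0 else gaussianReal m b⁻¹

instance (m : ℝ) (b : ℝ≥0) : IsProbabilityMeasure (coordLaw m b) := by
  unfold coordLaw; split_ifs <;> infer_instance

/-- For `b = 0` both laws are the same Dirac mass and the density is `exp 0`, so unsampled
coordinates fit the Gaussian formula. -/
theorem coordLaw_add (m θ : ℝ) (b : ℝ≥0) :
    coordLaw (m + θ) b = (coordLaw m b).withDensity
      fun x => ENNReal.ofReal (Real.exp (b * (θ * (x - m) - θ ^ 2 / 2))) := by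
  unfold coordLaw
  split_ifs with hb
  · simp [hb, withDensity_const]
  have hb' : b⁻¹ ≠ 0 := inv_ne_zero hb
  have hbR : (b : ℝ) ≠ 0 := by exact_mod_cast hb
  rw [gaussianReal_of_var_ne_zero _ hb', gaussianReal_of_var_ne_zero _ hb',
    ← withDensity_mul _ (measurable_gaussianPDF _ _) (by fun_prop)]
  congr 1
  funext x
  simp only [Pi.mul_apply, gaussianPDF]
  rw [← ENNReal.ofReal_mul (gaussianPDFReal_nonneg _ _ _)]
  congr 1
  simp only [gaussianPDFReal, NNReal.coe_inv]
  rw [mul_assoc _ (Real.exp _), ← Real.exp_add]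
  congr 2
  field_simp
  ring

theorem designLaw_eq {d : ℕ} (v : Fin d → ℝ) (B : Fin d → ℝ≥0) :
    designLaw v B = Measure.pi fun i => coordLaw (v i) (B i) := rfl

instance {d : ℕ} (v : Fin d → ℝ) (B : Fin d → ℝ≥0) : IsProbabilityMeasure (designLaw v B) := by
  rw [designLaw_eq]; infer_instance

theorem isoLaw_eq_designLaw {d : ℕ} (v : Fin d → ℝ) : isoLaw v = designLaw v 1 := by
  simp [isoLaw, designLaw]

/-- The likelihood ratio between the means `w + u` and `w` under the strategy `B`. -/
noncomputable def likelihoodRatio {d : ℕ} (B : Fin d → ℝ≥0) (w u y : Fin d → ℝ) : ℝ≥0∞ :=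
  ENNReal.ofReal (Real.exp (∑ i, (B i : ℝ) * (u i * (y i - w i) - u i ^ 2 / 2)))

theorem measurable_likelihoodRatio {d : ℕ} (B : Fin d → ℝ≥0) (w u : Fin d → ℝ) :
    Measurable (likelihoodRatio B w u) := by
  unfold likelihoodRatio; fun_prop

theorem designLaw_add {d : ℕ} (w u : Fin d → ℝ) (B : Fin d → ℝ≥0) :
    designLaw (w + u) B = (designLaw w B).withDensity (likelihoodRatio B w u) := by
  have h : ∀ i, IsProbabilityMeasure ((coordLaw (w i) (B i)).withDensity
      fun x => ENNReal.ofReal (Real.exp (B i * (u i * (x - w i) - u i ^ 2 / 2)))) := fun i => by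
    rw [← coordLaw_add]; infer_instance
  simp only [designLaw_eq, Pi.add_apply, coordLaw_add]
  rw [pi_withDensity (fun i => coordLaw (w i) (B i)) (fun i => by fun_prop)]
  congr 1
  funext y
  rw [likelihoodRatio, Real.exp_sum, ENNReal.ofReal_prod_of_nonneg fun i _ => (Real.exp_pos _).le]

theorem lintegral_likelihoodRatio {d : ℕ} (B : Fin d → ℝ≥0) (w u : Fin d → ℝ) :
    ∫⁻ y, likelihoodRatio B w u y ∂designLaw w B = 1 := by
  have h : designLaw (w + u) B Set.univ = 1 := measure_univ
  rwa [designLaw_add, withDensity_apply _ MeasurableSet.univ, Measure.restrict_univ] at h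

/-- The squared ratio for the shift `u` is a constant times the ratio for `2u`, which integrates to
one. -/
theorem lintegral_likelihoodRatio_sq {d : ℕ} (B : Fin d → ℝ≥0) (w u : Fin d → ℝ) :
    ∫⁻ y, likelihoodRatio B w u y ^ 2 ∂designLaw w B =
      ENNReal.ofReal (Real.exp (∑ i, (B i : ℝ) * u i ^ 2)) := by
  have h : ∀ y, likelihoodRatio B w u y ^ 2 =
      ENNReal.ofReal (Real.exp (∑ i, (B i : ℝ) * u i ^ 2)) *
        likelihoodRatio B w (fun i => 2 * u i) y := by
    intro y
    rw [likelihoodRatio, likelihoodRatio, ← ENNReal.ofReal_pow (Real.exp_pos _).le,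
      ← ENNReal.ofReal_mul (Real.exp_pos _).le, ← Real.exp_nat_mul, ← Real.exp_add,
      ← Finset.sum_add_distrib, Finset.mul_sum]
    congr 2
    refine Finset.sum_congr rfl fun i _ => ?_
    push_cast
    ring
  simp_rw [h]
  rw [lintegral_const_mul _ (measurable_likelihoodRatio _ _ _), lintegral_likelihoodRatio, mul_one]

theorem likelihoodRatio_single {d : ℕ} (B : Fin d → ℝ≥0) (w y : Fin d → ℝ) (j : Fin d) (θ : ℝ) :
    likelihoodRatio B w (Pi.single j θ) y =
      ENNReal.ofReal (Real.exp (B j * (θ * (y j - w j) - θ ^ 2 / 2))) := by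
  unfold likelihoodRatio
  rw [Finset.sum_eq_single j]
  · simp
  · intro i _ hij
    simp [hij]
  · simp

/-- A Chernoff bound for both tails of one coordinate, according to the sign of `θ`. -/
theorem designLaw_tail_le {d : ℕ} (v : Fin d → ℝ) (B : Fin d → ℝ≥0) (i : Fin d) (θ : ℝ) :
    designLaw v B {y | θ ^ 2 ≤ θ * (y i - v i)} ≤
      ENNReal.ofReal (Real.exp (-(B i * θ ^ 2 / 2))) := by
  set c : ℝ≥0∞ := ENNReal.ofReal (Real.exp (-(B i * θ ^ 2 / 2))) with hc
  have hm : MeasurableSet {y : Fin d → ℝ | θ ^ 2 ≤ θ * (y i - v i)} :=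
    measurableSet_le measurable_const (by fun_prop)
  calc designLaw v B {y | θ ^ 2 ≤ θ * (y i - v i)}
      = ∫⁻ y, Set.indicator {y | θ ^ 2 ≤ θ * (y i - v i)} 1 y ∂designLaw v B := by
        rw [lintegral_indicator_one hm]
    _ ≤ ∫⁻ y, c * likelihoodRatio B v (Pi.single i θ) y ∂designLaw v B := by
        refine lintegral_mono fun y => ?_
        by_cases hy : y ∈ {y : Fin d → ℝ | θ ^ 2 ≤ θ * (y i - v i)}
        swap
        · simp [Set.indicator_of_notMem hy]
        -- On the event, the ratio for the shift `θ` is at least `exp (B i * θ ^ 2 / 2) = c⁻¹`.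
        rw [Set.indicator_of_mem hy, likelihoodRatio_single, hc, ← ENNReal.ofReal_mul (Real.exp_pos _).le, ← Real.exp_add,
          Pi.one_apply, ENNReal.one_le_ofReal, Real.one_le_exp_iff]
        have hy' : θ ^ 2 ≤ θ * (y i - v i) := hy
        nlinarith [(B i).coe_nonneg]
    _ = c := by
        rw [lintegral_const_mul _ (measurable_likelihoodRatio _ _ _), lintegral_likelihoodRatio,
          mul_one]

/-- Truncating the likelihood ratio at level `M`. -/
theorem designLaw_add_single_le {d : ℕ} (w : Fin d → ℝ) (B : Fin d → ℝ≥0) (j : Fin d) (θ : ℝ)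
    {M : ℝ} (hM : 0 < M) {A : Set (Fin d → ℝ)} (hA : MeasurableSet A) :
    (designLaw (w + Pi.single j θ) B).real A ≤
      M * (designLaw w B).real A + Real.exp (B j * θ ^ 2) / M := by
  -- Either `x ≤ M`, or `x ≤ x ^ 2 / M`.
  have hpt : ∀ x : ℝ≥0∞, x ≤ ENNReal.ofReal M + ENNReal.ofReal M⁻¹ * x ^ 2 := by
    intro x
    rcases le_total x (ENNReal.ofReal M) with h | h
    · exact h.trans le_self_add
    · refine le_trans ?_ le_add_self
      calc x = ENNReal.ofReal M⁻¹ * (ENNReal.ofReal M * x) := by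
            rw [← mul_assoc, ← ENNReal.ofReal_mul (inv_pos.2 hM).le, inv_mul_cancel₀ hM.ne']
            simp
        _ ≤ ENNReal.ofReal M⁻¹ * x ^ 2 := by rw [sq]; gcongr
  have hsum : ∑ i, (B i : ℝ) * (Pi.single j θ : Fin d → ℝ) i ^ 2 = B j * θ ^ 2 := by
    rw [Finset.sum_eq_single j]
    · simp
    · intro i _ hij
      simp [hij]
    · simp
  have key : designLaw (w + Pi.single j θ) B A ≤
      ENNReal.ofReal M * designLaw w B A + ENNReal.ofReal (Real.exp (B j * θ ^ 2) / M) := by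
    rw [designLaw_add, withDensity_apply _ hA]
    calc ∫⁻ y in A, likelihoodRatio B w (Pi.single j θ) y ∂designLaw w B
        ≤ ∫⁻ y in A, (ENNReal.ofReal M +
            ENNReal.ofReal M⁻¹ * likelihoodRatio B w (Pi.single j θ) y ^ 2) ∂designLaw w B :=
          lintegral_mono fun y => hpt _
      _ = ENNReal.ofReal M * designLaw w B A + ENNReal.ofReal M⁻¹ *
            ∫⁻ y in A, likelihoodRatio B w (Pi.single j θ) y ^ 2 ∂designLaw w B := by
          rw [lintegral_add_left measurable_const, lintegral_const, Measure.restrict_apply_univ,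
            lintegral_const_mul _ ((measurable_likelihoodRatio _ _ _).pow_const 2)]
      _ ≤ ENNReal.ofReal M * designLaw w B A + ENNReal.ofReal M⁻¹ *
            ∫⁻ y, likelihoodRatio B w (Pi.single j θ) y ^ 2 ∂designLaw w B := by
          gcongr
          exact Measure.restrict_le_self
      _ = _ := by
          rw [lintegral_likelihoodRatio_sq, hsum, ← ENNReal.ofReal_mul (inv_pos.2 hM).le,
            inv_mul_eq_div]
  have hfin : ENNReal.ofReal M * designLaw w B A ≠ ∞ :=
    ENNReal.mul_ne_top ENNReal.ofReal_ne_top (measure_ne_top _ _)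
  have := ENNReal.toReal_mono (ENNReal.add_ne_top.2 ⟨hfin, ENNReal.ofReal_ne_top⟩) key
  rwa [ENNReal.toReal_add hfin ENNReal.ofReal_ne_top, ENNReal.toReal_mul,
    ENNReal.toReal_ofReal hM.le, ENNReal.toReal_ofReal (by positivity)] at this

end Density

/-! ### Risk bounds for many one-coordinate shifts -/

section Risk

variable {d : ℕ} {ι : Type}

theorem IsEstimator.measurableSet_eq {T : (Fin d → ℝ) → ι} (hT : IsEstimator T) (j : ι) :
    MeasurableSet {y | T y = j} :=
  @hT {j} trivial

theorem maxRisk_le_one (P : ι → Measure (Fin d → ℝ)) [∀ j, IsProbabilityMeasure (P j)]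
    (T : (Fin d → ℝ) → ι) : maxRisk P T ≤ 1 :=
  iSup_le fun _ => prob_le_one

theorem lawMinimaxRisk_le_one [Nonempty ι] (P : ι → Measure (Fin d → ℝ))
    [∀ j, IsProbabilityMeasure (P j)] : lawMinimaxRisk P ≤ 1 :=
  iInf₂_le_of_le (fun _ => Classical.arbitrary ι) (@measurable_const _ _ ⊤ _ _)
    (maxRisk_le_one P _)

theorem one_sub_le_maxRisk_real (P : ι → Measure (Fin d → ℝ)) [∀ j, IsProbabilityMeasure (P j)]
    {T : (Fin d → ℝ) → ι} (hT : IsEstimator T) (j : ι) :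
    1 - (P j).real {y | T y = j} ≤ (maxRisk P T).toReal := by
  have h : (P j).real {y | T y = j}ᶜ = 1 - (P j).real {y | T y = j} :=
    probReal_compl_eq_one_sub (hT.measurableSet_eq j)
  rw [← h]
  exact ENNReal.toReal_mono ((maxRisk_le_one P T).trans_lt ENNReal.one_lt_top).ne
    (le_iSup (fun j => P j {y | T y ≠ j}) j)

/-- If the means `w + θ e_j`, `j ∈ C`, all belong to the family and the coordinates in `C` are
sampled with effort at most `β`, then no estimator can recover the mean reliably. -/
theorem le_maxRisk_of_single_shifts (v : ι → Fin d → ℝ) (B : Fin d → ℝ≥0) (w : Fin d → ℝ) (θ β : ℝ)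
    (C : Finset (Fin d)) (hC : C.Nonempty) (hB : ∀ j ∈ C, (B j : ℝ) ≤ β) (S : Fin d → ι)
    (hS : Set.InjOn S C) (hv : ∀ j ∈ C, v (S j) = w + Pi.single j θ)
    {T : (Fin d → ℝ) → ι} (hT : IsEstimator T) :
    ENNReal.ofReal (1 - (1 + Real.exp (β * θ ^ 2)) / √(C.card : ℝ)) ≤
      maxRisk (fun j => designLaw (v j) B) T := by
  set r := maxRisk (fun j => designLaw (v j) B) T with hr
  have hr1 : r ≠ ∞ := ((maxRisk_le_one _ T).trans_lt ENNReal.one_lt_top).ne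
  rw [ENNReal.ofReal_le_iff_le_toReal hr1]
  have hm : (0 : ℝ) < C.card := by exact_mod_cast hC.card_pos
  -- After averaging over `C` the two error terms are `M / |C|` and `exp (β * θ ^ 2) / M`; this
  -- level makes both of order `|C| ^ (-1/2)`.
  set M := √(C.card : ℝ) with hMdef
  have hM : 0 < M := Real.sqrt_pos.2 hm
  have hMM : M * M = C.card := Real.mul_self_sqrt hm.le
  have h1 : ∀ j ∈ C, 1 - r.toReal ≤
      M * (designLaw w B).real {y | T y = S j} + Real.exp (β * θ ^ 2) / M := by
    intro j hj
    have h2 := one_sub_le_maxRisk_real (fun j => designLaw (v j) B) hT (S j)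
    simp only [hv j hj] at h2
    have h3 := designLaw_add_single_le w B j θ hM (hT.measurableSet_eq (S j))
    have h4 : Real.exp (B j * θ ^ 2) / M ≤ Real.exp (β * θ ^ 2) / M := by
      have := hB j hj
      gcongr
    linarith
  have h2 := Finset.sum_le_sum h1
  rw [Finset.sum_const, Finset.sum_add_distrib, Finset.sum_const, ← Finset.mul_sum, nsmul_eq_mul,
    nsmul_eq_mul] at h2
  have h3 : ∑ j ∈ C, (designLaw w B).real {y | T y = S j} ≤ 1 := by
    rw [← measureReal_biUnion_finset]
    · exact measureReal_le_one
    · intro i hi j hj hij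
      refine Set.disjoint_left.2 fun y hy hy' => hij (hS hi hj ?_)
      exact (show T y = S i from hy).symm.trans hy'
    · exact fun j _ => hT.measurableSet_eq _
  rw [sub_le_comm, le_div_iff₀ hM]
  have h4 : (C.card : ℝ) * (1 - r.toReal) ≤ M + C.card * (Real.exp (β * θ ^ 2) / M) :=
    h2.trans (by nlinarith)
  rw [← hMM] at h4
  have h5 : M * M * (Real.exp (β * θ ^ 2) / M) = M * Real.exp (β * θ ^ 2) := by
    field_simp
  rw [h5] at h4
  have h6 : M * (M * (1 - r.toReal)) ≤ M * (1 + Real.exp (β * θ ^ 2)) := by linarith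
  linarith [le_of_mul_le_mul_left h6 hM]

end Risk

/-! ### Maximum likelihood: existence and error bound -/

section MaximumLikelihood

/-- Induction over the candidates, updating a running minimizer; measurability of its attained value
is carried along to make the next comparison measurable. -/
theorem exists_isEstimator_argmin {d : ℕ} {ι : Type} [Fintype ι] [Nonempty ι]
    (q : ι → (Fin d → ℝ) → ℝ) (hq : ∀ j, Measurable (q j)) :
    ∃ T : (Fin d → ℝ) → ι, IsEstimator T ∧ ∀ y j, q (T y) y ≤ q j y := by
  classical
  have h : ∀ s : Finset ι, s.Nonempty →
      ∃ T : (Fin d → ℝ) → ι, IsEstimator T ∧ (Measurable fun y => q (T y) y) ∧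
        ∀ y, ∀ j ∈ s, q (T y) y ≤ q j y := by
    intro s hs
    induction hs using Finset.Nonempty.cons_induction with
    | singleton a => exact ⟨fun _ => a, @measurable_const _ _ ⊤ _ _, hq a, by simp⟩
    | cons a s ha hs ih =>
      obtain ⟨T, hT, hTq, hmin⟩ := ih
      have hset : MeasurableSet {y | q a y ≤ q (T y) y} := measurableSet_le (hq a) hTq
      refine ⟨fun y => if q a y ≤ q (T y) y then a else T y,
        by
          let _ : MeasurableSpace ι := ⊤
          exact Measurable.ite hset measurable_const hT, ?_, ?_⟩
      · have : (fun y => q (if q a y ≤ q (T y) y then a else T y) y) =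
            fun y => if q a y ≤ q (T y) y then q a y else q (T y) y := by
          funext y
          split_ifs <;> rfl
        rw [this]
        exact Measurable.ite hset (hq a) hTq
      · intro y j hj
        rw [Finset.mem_cons] at hj
        dsimp only
        split_ifs with hy
        · rcases hj with rfl | hj
          · exact le_rfl
          · exact hy.trans (hmin y j hj)
        · rcases hj with rfl | hj
          · exact (not_le.1 hy).le
          · exact hmin y j hj
  obtain ⟨T, hT, -, hmin⟩ := h Finset.univ Finset.univ_nonempty
  exact ⟨T, hT, fun y j => hmin y j (Finset.mem_univ j)⟩

theorem exists_isDesignMLE {d : ℕ} {ι : Type} [Fintype ι] [Nonempty ι] (v : ι → Fin d → ℝ)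
    (B : Fin d → ℝ≥0) : ∃ T, IsDesignMLE v B T :=
  exists_isEstimator_argmin (fun j y => ∑ i, (B i : ℝ) * (v j i - y i) ^ 2)
    fun j => by fun_prop

theorem isMLE_iff_isDesignMLE_one {d : ℕ} {ι : Type} (v : ι → Fin d → ℝ)
    (T : (Fin d → ℝ) → ι) : IsMLE v T ↔ IsDesignMLE v 1 T := by
  simp [IsMLE, IsDesignMLE]

theorem nonempty_kSubset {d k : ℕ} (h : k ≤ d) : Nonempty (KSubset d k) := by
  obtain ⟨S, -, hS⟩ := Finset.exists_subset_card_eq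
    (s := (Finset.univ : Finset (Fin d))) (n := k) (by simpa using h)
  exact ⟨⟨S, hS⟩⟩

/-- Under uniform sampling the maximum likelihood estimator errs only if some coordinate deviates
by at least `|μ| / 2` from its mean. -/
theorem maxRisk_designMLE_le {d k : ℕ} (μ : ℝ) {b : ℝ≥0} (hb : 0 < b)
    {T : (Fin d → ℝ) → KSubset d k} (hT : IsDesignMLE (kSets d k μ) (fun _ => b) T) :
    maxRisk (fun S => designLaw (kSets d k μ S) fun _ => b) T ≤
      ENNReal.ofReal (d * Real.exp (-(b * μ ^ 2 / 8))) := by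
  refine iSup_le fun S => ?_
  set v := kSets d k μ S with hv
  -- The sign of `θ i` selects the harmful direction: towards `0` on `S`, towards `μ` off it.
  set θ : Fin d → ℝ := fun i => if i ∈ S.1 then -(μ / 2) else μ / 2 with hθ
  have hθ2 : ∀ i, θ i ^ 2 = μ ^ 2 / 4 := by
    intro i
    simp only [hθ]
    split_ifs <;> ring
  have hsub : {y | T y ≠ S} ⊆ ⋃ i, {y | θ i ^ 2 ≤ θ i * (y i - v i)} := by
    intro y hy
    by_contra hgood
    simp only [Set.mem_iUnion, Set.mem_ofPred_eq, not_exists, not_le] at hgood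
    have hne : ∃ i, ¬ (i ∈ (T y).1 ↔ i ∈ S.1) := by
      by_contra hall
      push Not at hall
      exact hy (Subtype.ext (Finset.ext hall))
    obtain ⟨i₀, hi₀⟩ := hne
    -- Without a harmful deviation `S` is the better choice at each coordinate separately, so the
    -- constraint `|S| = k` plays no role.
    have hflip : ∀ i, ¬ (i ∈ (T y).1 ↔ i ∈ S.1) →
        (v i - y i) ^ 2 < (kSets d k μ (T y) i - y i) ^ 2 := by
      intro i hi
      have hg := hgood i
      rw [hθ2] at hg
      by_cases hS : i ∈ S.1
      · have hTi : i ∉ (T y).1 := by tauto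
        simp only [hθ, hv, kSets, hS, hTi, if_true, if_false] at hg ⊢
        nlinarith
      · have hTi : i ∈ (T y).1 := by tauto
        simp only [hθ, hv, kSets, hS, hTi, if_true, if_false] at hg ⊢
        nlinarith
    have hlt : ∑ i, (b : ℝ) * (v i - y i) ^ 2 <
        ∑ i, (b : ℝ) * (kSets d k μ (T y) i - y i) ^ 2 := by
      refine Finset.sum_lt_sum (fun i _ => ?_) ⟨i₀, Finset.mem_univ _, ?_⟩
      · by_cases hi : i ∈ (T y).1 ↔ i ∈ S.1
        · have : kSets d k μ (T y) i = v i := by simp only [hv, kSets, hi]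
          rw [this]
        · exact mul_le_mul_of_nonneg_left (hflip i hi).le b.coe_nonneg
      · exact mul_lt_mul_of_pos_left (hflip i₀ hi₀) (by exact_mod_cast hb)
    exact absurd (hT.2 y S) (not_le.2 hlt)
  calc designLaw v (fun _ => b) {y | T y ≠ S}
      ≤ ∑ i, designLaw v (fun _ => b) {y | θ i ^ 2 ≤ θ i * (y i - v i)} :=
        (measure_mono hsub).trans (measure_iUnion_fintype_le _ _)
    _ ≤ ∑ _i : Fin d, ENNReal.ofReal (Real.exp (-(b * μ ^ 2 / 8))) := by
        refine Finset.sum_le_sum fun i _ => ?_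
        refine (designLaw_tail_le v (fun _ => b) i (θ i)).trans_eq ?_
        rw [hθ2]
        congr 3
        ring
    _ = _ := by
        rw [Finset.sum_const, Finset.card_univ, Fintype.card_fin, nsmul_eq_mul,
          ENNReal.ofReal_mul (Nat.cast_nonneg d), ENNReal.ofReal_natCast]

end MaximumLikelihood

/-! ### Lower bound for every design within the budget -/

section LowerBound

theorem le_budgetMinimaxRisk_kSets {d k : ℕ} (hk : 1 ≤ k) (hkd : k < d) (μ : ℝ) {τ : ℝ≥0}
    (hτ : 0 < τ) :
    ENNReal.ofReal (1 - 2 * (1 + Real.exp (4 * τ / d * μ ^ 2)) / √(d : ℝ)) ≤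
      budgetMinimaxRisk (kSets d k μ) τ := by
  have hd : (0 : ℝ) < d := by exact_mod_cast (by omega : 0 < d)
  have hτ' : (0 : ℝ) < τ := by exact_mod_cast hτ
  refine le_iInf₂ fun B hB => le_iInf₂ fun T hT => ?_
  -- By Markov's inequality at most `d/4` coordinates exceed this effort.
  set β : ℝ := 4 * τ / d with hβ
  have hβ0 : 0 < β := by positivity
  set H : Finset (Fin d) := {i | β < (B i : ℝ)} with hH
  have hHcard : 4 * H.card ≤ d := by
    have h1 : (H.card : ℝ) * β ≤ τ := by
      calc (H.card : ℝ) * β = ∑ _i ∈ H, β := by rw [Finset.sum_const, nsmul_eq_mul]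
        _ ≤ ∑ i ∈ H, (B i : ℝ) :=
          Finset.sum_le_sum fun i hi => (Finset.mem_filter.1 hi).2.le
        _ ≤ ∑ i, (B i : ℝ) :=
          Finset.sum_le_sum_of_subset_of_nonneg (Finset.subset_univ _)
            fun i _ _ => (B i).coe_nonneg
        _ ≤ τ := by exact_mod_cast hB
    have h2 : (H.card : ℝ) * 4 * τ ≤ d * τ := by
      have : (H.card : ℝ) * β = H.card * 4 * τ / d := by rw [hβ]; ring
      rw [this, div_le_iff₀ hd] at h1
      linarith
    have h3 : (H.card : ℝ) * 4 ≤ d := le_of_mul_le_mul_right h2 hτ'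
    have h4 : H.card * 4 ≤ d := by exact_mod_cast h3
    omega
  obtain ⟨C, hCcard, hCH, w, θ, hθ, S, hS, hv⟩ :
      ∃ C : Finset (Fin d), d ≤ 4 * C.card ∧ (∀ j ∈ C, j ∉ H) ∧ ∃ (w : Fin d → ℝ) (θ : ℝ),
        θ ^ 2 = μ ^ 2 ∧ ∃ S : Fin d → KSubset d k, Set.InjOn S C ∧
          ∀ j ∈ C, kSets d k μ (S j) = w + Pi.single j θ := by
    have hne : Nonempty (KSubset d k) := nonempty_kSubset hkd.le
    -- If `2k ≤ d`, add one element to a set of size `k - 1`; otherwise remove one from a set of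
    -- size `k + 1`. Either way at least `d/2` positions are available, and discarding `H` leaves
    -- `d/4`. The arbitrary default is never used on `C`.
    rcases le_or_gt (2 * k) d with h2k | h2k
    · obtain ⟨A, -, hA⟩ := Finset.exists_subset_card_eq
        (s := (Finset.univ : Finset (Fin d))) (n := k - 1) (by simp; omega)
      refine ⟨(A ∪ H)ᶜ, ?_, fun j hj => ?_, fun i => if i ∈ A then μ else 0, μ, rfl,
        fun j => if h : j ∉ A then ⟨insert j A, by rw [Finset.card_insert_of_notMem h]; omega⟩
          else Classical.arbitrary _, ?_, ?_⟩
      · have h1 := Finset.card_union_le A H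
        rw [Finset.card_compl, Fintype.card_fin]
        omega
      · simp only [Finset.mem_compl, Finset.mem_union, not_or] at hj
        exact hj.2
      · intro i hi j hj hij
        simp only [Finset.coe_compl, Set.mem_compl_iff, Finset.mem_coe, Finset.mem_union,
          not_or] at hi hj
        simp only [hi.1, hj.1, not_false_eq_true, dif_pos, Subtype.mk.injEq] at hij
        have : i ∈ insert j A := hij ▸ Finset.mem_insert_self i A
        exact (Finset.mem_insert.1 this).resolve_right hi.1
      · intro j hj
        simp only [Finset.mem_compl, Finset.mem_union, not_or] at hj
        funext i
        simp only [hj.1, not_false_eq_true, dif_pos, kSets, Pi.add_apply, Finset.mem_insert]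
        by_cases hij : i = j
        · subst hij
          simp [hj.1]
        · simp [hij]
    · obtain ⟨A, -, hA⟩ := Finset.exists_subset_card_eq
        (s := (Finset.univ : Finset (Fin d))) (n := k + 1) (by simp; omega)
      refine ⟨A \ H, ?_, fun j hj => (Finset.mem_sdiff.1 hj).2, fun i => if i ∈ A then μ else 0,
        -μ, by ring, fun j => if h : j ∈ A then ⟨A.erase j, by
          rw [Finset.card_erase_of_mem h]; omega⟩ else Classical.arbitrary _, ?_, ?_⟩
      · have h1 := Finset.le_card_sdiff H A
        omega
      · intro i hi j hj hij
        simp only [Finset.coe_sdiff, Set.mem_sdiff, Finset.mem_coe] at hi hj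
        simp only [hi.1, hj.1, dif_pos, Subtype.mk.injEq] at hij
        by_contra hne
        have : i ∈ A.erase j := Finset.mem_erase.2 ⟨hne, hi.1⟩
        rw [← hij] at this
        exact (Finset.notMem_erase i A) this
      · intro j hj
        have hjA := (Finset.mem_sdiff.1 hj).1
        funext i
        simp only [hjA, dif_pos, kSets, Pi.add_apply, Finset.mem_erase]
        by_cases hij : i = j
        · subst hij
          simp [hjA]
        · simp [hij]
  have hCpos : 0 < C.card := by omega
  refine le_trans (ENNReal.ofReal_le_ofReal ?_)
    (le_maxRisk_of_single_shifts (kSets d k μ) B w θ β C (Finset.card_pos.1 hCpos)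
      (fun j hj => ?_) S hS hv hT)
  · rw [hθ]
    refine sub_le_sub_left ?_ 1
    have hs : √(d : ℝ) ≤ 2 * √(C.card : ℝ) := by
      rw [Real.sqrt_le_left (by positivity), mul_pow, Real.sq_sqrt (Nat.cast_nonneg _)]
      exact_mod_cast (by omega : d ≤ 2 ^ 2 * C.card)
    have hsC : 0 < √(C.card : ℝ) := Real.sqrt_pos.2 (by exact_mod_cast hCpos)
    rw [div_le_div_iff₀ hsC (Real.sqrt_pos.2 hd)]
    nlinarith [Real.exp_pos (β * μ ^ 2)]
  · by_contra hlt
    exact hCH j hj (Finset.mem_filter.2 ⟨Finset.mem_univ _, not_le.1 hlt⟩)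

end LowerBound

/-! ### Minimax rates -/

section Rates

variable {d k : ℕ → ℕ}

/-- Expanding `(k - 1) * (d - k - 1) ≥ 0` gives `k * (d - k) ≥ d - 1`, and `d ≥ 2`. -/
theorem half_le_mul_sub {d k : ℕ} (hk : 1 ≤ k) (hkd : k < d) :
    (d : ℝ) / 2 ≤ (k : ℝ) * ((d : ℝ) - k) := by
  have h1 : (1 : ℝ) ≤ k := by exact_mod_cast hk
  have h2 : (1 : ℝ) ≤ (d : ℝ) - k := by
    have : ((k + 1 : ℕ) : ℝ) ≤ d := by exact_mod_cast hkd
    push_cast at this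
    linarith
  nlinarith [mul_nonneg (sub_nonneg.2 h1) (sub_nonneg.2 h2)]

theorem mul_sub_le_sq {d k : ℕ} : (k : ℝ) * ((d : ℝ) - k) ≤ (d : ℝ) ^ 2 := by
  nlinarith [sq_nonneg ((d : ℝ) - 2 * k), sq_nonneg (d : ℝ)]

theorem tendsto_errorBound_zero (hd : Tendsto d atTop atTop) (hk : ∀ n, 1 ≤ k n)
    (hkd : ∀ n, k n < d n) {τ : ℕ → ℝ≥0} (hτ : ∀ n, 0 < τ n) {μ : ℕ → ℝ}
    (h : (fun n => √((d n : ℝ) / (τ n : ℝ) * Real.log ((k n : ℝ) * ((d n : ℝ) - (k n : ℝ)))))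
      =o[atTop] μ) :
    Tendsto (fun n => ENNReal.ofReal (d n * Real.exp (-((τ n : ℝ) / d n * μ n ^ 2 / 8))))
      atTop (𝓝 0) := by
  have hdR : Tendsto (fun n => (d n : ℝ)) atTop atTop := tendsto_natCast_atTop_atTop.comp hd
  have hlim : Tendsto (fun n => ENNReal.ofReal (4 / (d n : ℝ))) atTop (𝓝 0) := by
    have := ENNReal.tendsto_ofReal (hdR.const_div_atTop 4)
    rwa [ENNReal.ofReal_zero] at this
  refine tendsto_of_tendsto_of_tendsto_of_le_of_le' tendsto_const_nhds hlim
    (Eventually.of_forall fun _ => zero_le) ?_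
  have hlog : ∀ᶠ n in atTop, (2 : ℝ) ≤ d n := hdR.eventually_ge_atTop 2
  -- The factor `1/4` makes the exponent at least `2 * log (d / 2)`, so the bound becomes `d * (2 /
  -- d) ^ 2 = 4 / d`.
  filter_upwards [h.bound (by norm_num : (0 : ℝ) < 1 / 4), hlog] with n hn h2
  refine ENNReal.ofReal_le_ofReal ?_
  have hd0 : (0 : ℝ) < d n := by linarith
  have hτ0 : (0 : ℝ) < τ n := by exact_mod_cast hτ n
  have hL := half_le_mul_sub (hk n) (hkd n)
  have hLlog : Real.log (d n / 2) ≤ Real.log ((k n : ℝ) * ((d n : ℝ) - k n)) :=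
    Real.log_le_log (by linarith) hL
  have hL0 : 0 ≤ Real.log ((d n : ℝ) / 2) := Real.log_nonneg (by linarith)
  rw [Real.norm_of_nonneg (Real.sqrt_nonneg _), Real.sqrt_le_left (by positivity), mul_pow,
    Real.norm_eq_abs, sq_abs] at hn
  have hexp : 2 * Real.log (d n / 2) ≤ (τ n : ℝ) / d n * μ n ^ 2 / 8 := by
    have h3 : (τ n : ℝ) / d n * ((d n : ℝ) / τ n *
        Real.log ((k n : ℝ) * ((d n : ℝ) - k n))) ≤ (τ n : ℝ) / d n * ((1 / 4) ^ 2 * μ n ^ 2) :=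
      mul_le_mul_of_nonneg_left hn (by positivity)
    have h4 : (τ n : ℝ) / d n * ((d n : ℝ) / τ n *
        Real.log ((k n : ℝ) * ((d n : ℝ) - k n))) = Real.log ((k n : ℝ) * ((d n : ℝ) - k n)) := by
      field_simp
    rw [h4] at h3
    linarith
  calc (d n : ℝ) * Real.exp (-((τ n : ℝ) / d n * μ n ^ 2 / 8))
      ≤ d n * Real.exp (-(2 * Real.log (d n / 2))) := by gcongr
    _ = 4 / d n := by
      rw [Real.exp_neg, two_mul, Real.exp_add, Real.exp_log (by positivity)]
      field_simp
      norm_num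

theorem tendsto_lowerBound_one (hd : Tendsto d atTop atTop) (hk : ∀ n, 1 ≤ k n)
    (hkd : ∀ n, k n < d n) {τ : ℕ → ℝ≥0} (hτ : ∀ n, 0 < τ n) {μ : ℕ → ℝ}
    (h : μ =o[atTop]
      fun n => √((d n : ℝ) / (τ n : ℝ) * Real.log ((k n : ℝ) * ((d n : ℝ) - (k n : ℝ))))) :
    Tendsto (fun n => ENNReal.ofReal
      (1 - 2 * (1 + Real.exp (4 * τ n / d n * μ n ^ 2)) / √(d n : ℝ))) atTop (𝓝 1) := by
  have hdR : Tendsto (fun n => (d n : ℝ)) atTop atTop := tendsto_natCast_atTop_atTop.comp hd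
  have hx : Tendsto (fun n => -(Real.log (d n) / 4)) atTop atBot :=
    tendsto_neg_atTop_atBot.comp
      ((Real.tendsto_log_atTop.comp hdR).atTop_div_const (by norm_num))
  have hlim : Tendsto (fun n => ENNReal.ofReal (1 - 4 * Real.exp (-(Real.log (d n) / 4))))
      atTop (𝓝 1) := by
    have := ENNReal.tendsto_ofReal
      (((Real.tendsto_exp_atBot.comp hx).const_mul 4).const_sub 1)
    simpa using this
  refine tendsto_of_tendsto_of_tendsto_of_le_of_le' hlim tendsto_const_nhds ?_
    (Eventually.of_forall fun n => ?_)
  -- With `1/6` the exponent is at most `(2/9) * log d ≤ (1/4) * log d`, so the numerator is of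
  -- order `d ^ (1/4)`, against `√d` below.
  · filter_upwards [h.bound (by norm_num : (0 : ℝ) < 1 / 6), hdR.eventually_ge_atTop 2]
      with n hn h2
    refine ENNReal.ofReal_le_ofReal (sub_le_sub_left ?_ 1)
    have hd0 : (0 : ℝ) < d n := by linarith
    have hτ0 : (0 : ℝ) < τ n := by exact_mod_cast hτ n
    have hL := half_le_mul_sub (hk n) (hkd n)
    have hlog : Real.log ((k n : ℝ) * ((d n : ℝ) - k n)) ≤ 2 * Real.log (d n) := by
      rw [← Real.log_rpow hd0]
      exact Real.log_le_log (by linarith) (by simpa using mul_sub_le_sq)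
    have hlog0 : 0 ≤ Real.log ((k n : ℝ) * ((d n : ℝ) - k n)) :=
      Real.log_nonneg (by linarith)
    have hlogd : 0 ≤ Real.log (d n) := Real.log_nonneg (by linarith)
    rw [Real.norm_of_nonneg (Real.sqrt_nonneg _)] at hn
    have hsq : μ n ^ 2 ≤ (1 / 6) ^ 2 * ((d n : ℝ) / τ n *
        Real.log ((k n : ℝ) * ((d n : ℝ) - k n))) := by
      rw [← Real.sq_sqrt (mul_nonneg (div_nonneg hd0.le hτ0.le) hlog0), ← mul_pow, ← sq_abs]
      exact pow_le_pow_left₀ (abs_nonneg _) hn 2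
    have hexp : 4 * (τ n : ℝ) / d n * μ n ^ 2 ≤ Real.log (d n) / 4 := by
      have h3 := mul_le_mul_of_nonneg_left hsq (by positivity : 0 ≤ 4 * (τ n : ℝ) / d n)
      have h4 : 4 * (τ n : ℝ) / d n * ((1 / 6) ^ 2 * ((d n : ℝ) / τ n *
          Real.log ((k n : ℝ) * ((d n : ℝ) - k n)))) =
          Real.log ((k n : ℝ) * ((d n : ℝ) - k n)) / 9 := by
        field_simp
        ring
      rw [h4] at h3
      linarith
    have hsqrt : √(d n : ℝ) = Real.exp (Real.log (d n) / 4) * Real.exp (Real.log (d n) / 4) := by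
      rw [← Real.exp_add, Real.sqrt_eq_iff_mul_self_eq hd0.le (Real.exp_pos _).le, ← Real.exp_add]
      rw [show Real.log (d n) / 4 + Real.log (d n) / 4 +
        (Real.log (d n) / 4 + Real.log (d n) / 4) = Real.log (d n) by ring, Real.exp_log hd0]
    have h5 := Real.exp_le_exp.2 hexp
    have h6 : 1 ≤ Real.exp (Real.log (d n) / 4) := Real.one_le_exp (by positivity)
    rw [hsqrt, Real.exp_neg, div_le_iff₀ (by positivity)]
    have h7 : 4 * (Real.exp (Real.log (d n) / 4))⁻¹ *
        (Real.exp (Real.log (d n) / 4) * Real.exp (Real.log (d n) / 4)) =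
        4 * Real.exp (Real.log (d n) / 4) := by
      field_simp
    rw [h7]
    linarith
  · rw [← ENNReal.ofReal_one]
    refine ENNReal.ofReal_le_ofReal (sub_le_self _ (by positivity))

theorem budgetMinimaxRisk_le {d : ℕ} {ι : Type} (v : ι → Fin d → ℝ) {τ : ℝ≥0} {B : Fin d → ℝ≥0}
    (hB : ∑ i, B i ≤ τ) : budgetMinimaxRisk v τ ≤ lawMinimaxRisk fun j => designLaw (v j) B :=
  iInf₂_le B hB

theorem sum_uniformDesign_le (d : ℕ) (τ : ℝ≥0) : ∑ i, uniformDesign d τ i ≤ τ := by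
  simp only [uniformDesign, Finset.sum_const, Finset.card_univ, Fintype.card_fin, nsmul_eq_mul]
  rcases eq_or_ne (d : ℝ≥0) 0 with h | h
  · simp [h]
  · rw [mul_div_cancel₀ _ h]

theorem tendsto_maxRisk_uniformDesign (hd : Tendsto d atTop atTop) (hk : ∀ n, 1 ≤ k n)
    (hkd : ∀ n, k n < d n) {τ : ℕ → ℝ≥0} (hτ : ∀ n, 0 < τ n) {μ : ℕ → ℝ}
    (h : (fun n => √((d n : ℝ) / (τ n : ℝ) * Real.log ((k n : ℝ) * ((d n : ℝ) - (k n : ℝ)))))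
      =o[atTop] μ) {T : ∀ n, (Fin (d n) → ℝ) → KSubset (d n) (k n)}
    (hT : ∀ n, IsDesignMLE (kSets (d n) (k n) (μ n)) (uniformDesign (d n) (τ n)) (T n)) :
    Tendsto (fun n => maxRisk (fun S => designLaw (kSets (d n) (k n) (μ n) S)
      (uniformDesign (d n) (τ n))) (T n)) atTop (𝓝 0) := by
  refine tendsto_of_tendsto_of_tendsto_of_le_of_le tendsto_const_nhds
    (tendsto_errorBound_zero hd hk hkd hτ h) (fun _ => zero_le) fun n => ?_
  have hd0 : (0 : ℝ≥0) < d n := by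
    exact_mod_cast (Nat.zero_le _).trans_lt (hkd n)
  have := maxRisk_designMLE_le (μ n) (div_pos (hτ n) hd0) (hT n)
  rwa [NNReal.coe_div, NNReal.coe_natCast] at this

theorem isMinimaxRate_budget (hd : Tendsto d atTop atTop) (hk : ∀ n, 1 ≤ k n)
    (hkd : ∀ n, k n < d n) {τ : ℕ → ℝ≥0} (hτ : ∀ n, 0 < τ n) :
    IsMinimaxRate (fun n μ => budgetMinimaxRisk (kSets (d n) (k n) μ) (τ n))
      (fun n => √((d n : ℝ) / (τ n : ℝ) *
        Real.log ((k n : ℝ) * ((d n : ℝ) - (k n : ℝ))))) := by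
  have hne : ∀ n, Nonempty (KSubset (d n) (k n)) := fun n => nonempty_kSubset (hkd n).le
  refine fun μ => ⟨fun h => ?_, fun h => ?_⟩
  · choose T hT using fun n =>
      exists_isDesignMLE (kSets (d n) (k n) (μ n)) (uniformDesign (d n) (τ n))
    exact tendsto_of_tendsto_of_tendsto_of_le_of_le tendsto_const_nhds
      (tendsto_maxRisk_uniformDesign hd hk hkd hτ h hT) (fun _ => zero_le) fun n =>
        (budgetMinimaxRisk_le _ (sum_uniformDesign_le _ _)).trans (iInf₂_le (T n) (hT n).1)
  · exact tendsto_of_tendsto_of_tendsto_of_le_of_le (tendsto_lowerBound_one hd hk hkd hτ h)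
      tendsto_const_nhds (fun n => le_budgetMinimaxRisk_kSets (hk n) (hkd n) (μ n) (hτ n))
      fun n => (budgetMinimaxRisk_le _ (sum_uniformDesign_le _ _)).trans (lawMinimaxRisk_le_one _)

/-- The isotropic model is uniform sampling with budget `d`. The lower bound is inherited from the
budget problem, where the infimum runs over more designs. -/
theorem isMinimaxRate_isotropic (hd : Tendsto d atTop atTop) (hk : ∀ n, 1 ≤ k n)
    (hkd : ∀ n, k n < d n) :
    IsMinimaxRate (fun n μ => minimaxRisk (kSets (d n) (k n) μ))
      (fun n => √(Real.log ((k n : ℝ) * ((d n : ℝ) - (k n : ℝ))))) := by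
  have hne : ∀ n, Nonempty (KSubset (d n) (k n)) := fun n => nonempty_kSubset (hkd n).le
  have hd0 : ∀ n, (d n : ℝ≥0) ≠ 0 := fun n => by
    exact_mod_cast ((Nat.zero_le _).trans_lt (hkd n)).ne'
  have hτ : ∀ n, 0 < ((d n : ℝ≥0)) := fun n => pos_iff_ne_zero.2 (hd0 n)
  have hunif : ∀ n, uniformDesign (d n) (d n) = 1 := fun n => by
    funext i
    simp [uniformDesign, div_self (hd0 n)]
  have hrisk : ∀ n μ, minimaxRisk (kSets (d n) (k n) μ) =
      lawMinimaxRisk fun S => designLaw (kSets (d n) (k n) μ S)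
        (uniformDesign (d n) (d n)) := fun n μ => by
    simp only [minimaxRisk, isoLaw_eq_designLaw, hunif]
  have hrate : (fun n => √(Real.log ((k n : ℝ) * ((d n : ℝ) - (k n : ℝ))))) =
      fun n => √((d n : ℝ) / ((d n : ℝ≥0) : ℝ) *
        Real.log ((k n : ℝ) * ((d n : ℝ) - (k n : ℝ)))) := by
    funext n
    have : (d n : ℝ) ≠ 0 := by exact_mod_cast hd0 n
    rw [NNReal.coe_natCast, div_self this, one_mul]
  rw [hrate]
  simp only [hrisk]
  refine fun μ => ⟨fun h => ?_, fun h => ?_⟩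
  · choose T hT using fun n =>
      exists_isDesignMLE (kSets (d n) (k n) (μ n)) (uniformDesign (d n) (d n))
    exact tendsto_of_tendsto_of_tendsto_of_le_of_le tendsto_const_nhds
      (tendsto_maxRisk_uniformDesign hd hk hkd hτ h hT) (fun _ => zero_le) fun n =>
        iInf₂_le (T n) (hT n).1
  · exact tendsto_of_tendsto_of_tendsto_of_le_of_le
      ((isMinimaxRate_budget hd hk hkd hτ μ).2 h) tendsto_const_nhds
      (fun n => budgetMinimaxRisk_le _ (sum_uniformDesign_le _ _))
      fun n => lawMinimaxRisk_le_one _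

end Rates

/-! ### Permutation symmetry of the family -/

section Permutation

variable {d k : ℕ}

/-- The action of a permutation of the coordinates on `k`-subsets. -/
def permKSubset (σ : Equiv.Perm (Fin d)) : KSubset d k ≃ KSubset d k where
  toFun S := ⟨S.1.map σ.toEmbedding, by rw [Finset.card_map, S.2]⟩
  invFun S := ⟨S.1.map σ.symm.toEmbedding, by rw [Finset.card_map, S.2]⟩
  left_inv S := Subtype.ext (by ext; simp)
  right_inv S := Subtype.ext (by ext; simp)

theorem kSets_permKSubset (σ : Equiv.Perm (Fin d)) (μ : ℝ) (S : KSubset d k) (i : Fin d) :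
    kSets d k μ (permKSubset σ S) (σ i) = kSets d k μ S i := by
  simp [kSets, permKSubset]

theorem exists_permKSubset_eq (S S' : KSubset d k) : ∃ σ, permKSubset σ S = S' := by
  have e : {x // x ∈ S.1} ≃ {x // x ∈ S'.1} :=
    Fintype.equivOfCardEq (by simp [S.2, S'.2])
  refine ⟨e.extendSubtype, Subtype.ext (Finset.eq_of_subset_of_card_le ?_ ?_)⟩
  · intro x hx
    obtain ⟨y, hy, rfl⟩ := Finset.mem_map.1 hx
    exact e.extendSubtype_mem y hy
  · rw [S'.2, (permKSubset _ S).2]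

theorem kSets_injective {μ : ℝ} (hμ : μ ≠ 0) : Function.Injective (kSets d k μ) := by
  intro S S' h
  refine Subtype.ext (Finset.ext fun i => ?_)
  have hi := congrFun h i
  by_cases h1 : i ∈ S.1 <;> by_cases h2 : i ∈ S'.1 <;> simp_all [kSets]

theorem card_mul_sum_perm (b : Fin d → ℝ) (i : Fin d) :
    (d : ℝ) * ∑ σ : Equiv.Perm (Fin d), b (σ i) =
      Fintype.card (Equiv.Perm (Fin d)) * ∑ j, b j := by
  -- Right multiplication by the transposition of `i` and `j` reindexes one sum as the other.
  have h : ∀ j, ∑ σ : Equiv.Perm (Fin d), b (σ j) = ∑ σ : Equiv.Perm (Fin d), b (σ i) := fun j =>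
    Fintype.sum_equiv (Equiv.mulRight (Equiv.swap i j)) _ _ fun σ => by simp
  calc (d : ℝ) * ∑ σ : Equiv.Perm (Fin d), b (σ i)
      = ∑ j, ∑ σ : Equiv.Perm (Fin d), b (σ j) := by simp [h]
    _ = ∑ σ : Equiv.Perm (Fin d), ∑ j, b (σ j) := Finset.sum_comm
    _ = ∑ _σ : Equiv.Perm (Fin d), ∑ j, b j :=
        Finset.sum_congr rfl fun σ _ => Equiv.sum_comp σ b
    _ = _ := by simp

end Permutation

/-! ### Optimality of uniform sampling for the SEDF -/

section ExponentiatedDistance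

theorem sedf_uniformDesign_le {d k : ℕ} (hkd : k ≤ d) (μ : ℝ) {α : ℝ} (hα : 0 < α) {τ : ℝ≥0}
    {B : Fin d → ℝ≥0} (hB : ∑ i, B i ≤ τ) :
    sedf (kSets d k μ) α (uniformDesign d τ) ≤ sedf (kSets d k μ) α B := by
  have hne : Nonempty (KSubset d k) := nonempty_kSubset hkd
  refine ciSup_le fun S => ?_
  set W := sedf (kSets d k μ) α B with hW
  have hBR : ∑ i, (B i : ℝ) ≤ τ := by exact_mod_cast hB
  set N : ℝ := ((Fintype.card (Equiv.Perm (Fin d)) : ℕ) : ℝ) with hN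
  have hN0 : 0 < N := by
    rw [hN]
    exact_mod_cast Fintype.card_pos
  set δ : KSubset d k → Fin d → ℝ := fun R i => (kSets d k μ S i - kSets d k μ R i) ^ 2 with hδ
  have hδ0 : ∀ R i, 0 ≤ δ R i := fun R i => sq_nonneg _
  -- Permuting the design amounts to moving the base hypothesis from `S` to `permKSubset σ S`, which
  -- the maximum `W` also covers.
  have hperm : ∀ σ : Equiv.Perm (Fin d),
      ∑ R with R ≠ S, Real.exp (-(∑ i, (B (σ i) : ℝ) * δ R i) / α) ≤ W := by
    intro σ
    refine le_trans (le_of_eq ?_) (le_ciSup (Set.finite_range _).bddAbove (permKSubset σ S))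
    refine Finset.sum_equiv (permKSubset σ) (fun R => by simp) fun R _ => ?_
    congr 3
    refine (Fintype.sum_equiv σ _ _ fun i => ?_)
    simp only [kSets_permKSubset, hδ]
  have hjensen : ∀ R, Real.exp (-(∑ i, (uniformDesign d τ i : ℝ) * δ R i) / α) ≤
      ∑ σ : Equiv.Perm (Fin d), N⁻¹ * Real.exp (-(∑ i, (B (σ i) : ℝ) * δ R i) / α) := by
    intro R
    -- The averaged design is constant, equal to `(∑ B) / d`; it may fall short of `τ / d` when the
    -- budget is not exhausted.
    have hmean : ∑ σ : Equiv.Perm (Fin d), N⁻¹ * ∑ i, (B (σ i) : ℝ) * δ R i ≤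
        ∑ i, (uniformDesign d τ i : ℝ) * δ R i := by
      calc ∑ σ : Equiv.Perm (Fin d), N⁻¹ * ∑ i, (B (σ i) : ℝ) * δ R i
          = ∑ i, (N⁻¹ * ∑ σ : Equiv.Perm (Fin d), (B (σ i) : ℝ)) * δ R i := by
            rw [← Finset.mul_sum, Finset.sum_comm, Finset.mul_sum]
            exact Finset.sum_congr rfl fun i _ => by rw [← Finset.sum_mul, mul_assoc]
        _ ≤ _ := by
            refine Finset.sum_le_sum fun i _ => mul_le_mul_of_nonneg_right ?_ (hδ0 R i)
            have hd : (0 : ℝ) < d := by exact_mod_cast i.pos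
            have h := card_mul_sum_perm (fun j => (B j : ℝ)) i
            rw [uniformDesign, NNReal.coe_div, NNReal.coe_natCast, le_div_iff₀ hd, mul_assoc,
              mul_comm _ (d : ℝ), h, ← mul_assoc, inv_mul_cancel₀ hN0.ne', one_mul]
            exact hBR
    have hJ := convexOn_exp.map_sum_le (t := (Finset.univ : Finset (Equiv.Perm (Fin d))))
      (w := fun _ => N⁻¹) (p := fun σ => -(∑ i, (B (σ i) : ℝ) * δ R i) / α)
      (fun _ _ => (inv_pos.2 hN0).le) (by simp [hN]) (fun _ _ => Set.mem_univ _)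
    simp only [smul_eq_mul] at hJ
    refine le_trans (Real.exp_le_exp.2 ?_) hJ
    have : ∑ σ : Equiv.Perm (Fin d), N⁻¹ * (-(∑ i, (B (σ i) : ℝ) * δ R i) / α) =
        -(∑ σ : Equiv.Perm (Fin d), N⁻¹ * ∑ i, (B (σ i) : ℝ) * δ R i) / α := by
      rw [← Finset.sum_neg_distrib, Finset.sum_div]
      exact Finset.sum_congr rfl fun σ _ => by ring
    rw [this]
    gcongr
  calc ∑ R with R ≠ S, Real.exp (-(∑ i, (uniformDesign d τ i : ℝ) * δ R i) / α)
      ≤ ∑ R with R ≠ S, ∑ σ : Equiv.Perm (Fin d),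
          N⁻¹ * Real.exp (-(∑ i, (B (σ i) : ℝ) * δ R i) / α) :=
        Finset.sum_le_sum fun R _ => hjensen R
    _ = ∑ σ : Equiv.Perm (Fin d), N⁻¹ *
          ∑ R with R ≠ S, Real.exp (-(∑ i, (B (σ i) : ℝ) * δ R i) / α) := by
        rw [Finset.sum_comm]
        simp only [Finset.mul_sum]
    _ ≤ ∑ _σ : Equiv.Perm (Fin d), N⁻¹ * W :=
        Finset.sum_le_sum fun σ _ => mul_le_mul_of_nonneg_left (hperm σ) (inv_pos.2 hN0).le
    _ = W := by
        rw [Finset.sum_const, Finset.card_univ, nsmul_eq_mul, ← mul_assoc, ← hN,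
          mul_inv_cancel₀ hN0.ne', one_mul]

end ExponentiatedDistance

/-! ### Exact minimax optimality of the isotropic MLE -/

section ExactOptimality

variable {d : ℕ}

instance (v : Fin d → ℝ) : IsProbabilityMeasure (isoLaw v) := by
  rw [isoLaw_eq_designLaw]; infer_instance

/-- Hyperplanes are null sets for the isotropic Gaussian law. -/
theorem isoLaw_hyperplane (v a : Fin d → ℝ) (ha : a ≠ 0) (c : ℝ) :
    isoLaw v {y | ∑ i, a i * y i = c} = 0 := by
  have hind : iIndepFun (fun i (y : Fin d → ℝ) => a i * y i) (isoLaw v) :=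
    iIndepFun_pi (X := fun i (x : ℝ) => a i * x) fun i => by fun_prop
  have hmap : ∀ i, (isoLaw v).map (fun y => y i) = gaussianReal (v i) 1 := fun i =>
    (measurePreserving_eval (fun i => gaussianReal (v i) 1) i).map_eq
  have hgauss : ∀ i, HasGaussianLaw (fun y : Fin d → ℝ => a i * y i) (isoLaw v) := by
    intro i
    have h : HasGaussianLaw (fun y : Fin d → ℝ => y i) (isoLaw v) :=
      ⟨by rw [hmap]; infer_instance⟩
    simpa using h.fun_smul (a i)
  have hsum : HasGaussianLaw (fun y : Fin d → ℝ => ∑ i, a i * y i) (isoLaw v) := by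
    have h := (hind.hasGaussianLaw hgauss).map_fun
      (∑ i, ContinuousLinearMap.proj (R := ℝ) (φ := fun _ : Fin d => ℝ) i)
    simpa using h
  have hvar : Var[fun y : Fin d → ℝ => ∑ i, a i * y i; isoLaw v] = ∑ i, a i ^ 2 := by
    have h := variance_sum_pi (μ := fun i => gaussianReal (v i) 1)
      (X := fun i (x : ℝ) => a i * x) fun i => (memLp_id_gaussianReal 2).const_mul (a i)
    have hfun : (∑ i, fun y : Fin d → ℝ => a i * y i) = fun y => ∑ i, a i * y i := by
      funext y; simp
    rw [hfun] at h
    rw [isoLaw, h]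
    refine Finset.sum_congr rfl fun i _ => ?_
    rw [variance_const_mul, variance_fun_id_gaussianReal]
    simp
  have hpos : 0 < ∑ i, a i ^ 2 := by
    obtain ⟨i, hi⟩ := Function.ne_iff.1 ha
    exact Finset.sum_pos' (fun i _ => sq_nonneg _) ⟨i, Finset.mem_univ _, by
      have : a i ≠ 0 := hi
      positivity⟩
  have hv : (∑ i, a i ^ 2).toNNReal ≠ 0 := (Real.toNNReal_pos.2 hpos).ne'
  have hlaw := hsum.map_eq_gaussianReal
  rw [hvar] at hlaw
  have := nullSingletonClass_gaussianReal (μ := ∫ y, ∑ i, a i * y i ∂isoLaw v) hv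
  have h0 : (isoLaw v).map (fun y => ∑ i, a i * y i) {c} = 0 := by
    rw [hlaw]; exact measure_singleton c
  rwa [Measure.map_apply (by fun_prop) (measurableSet_singleton c)] at h0

theorem isoLaw_eq_withDensity (v : Fin d → ℝ) :
    isoLaw v = (isoLaw 0).withDensity (likelihoodRatio 1 0 v) := by
  rw [isoLaw_eq_designLaw, isoLaw_eq_designLaw, ← designLaw_add, zero_add]

/-- The maximum likelihood estimator is Bayes optimal for the uniform prior. -/
theorem sum_isoLaw_le_of_isMLE {ι : Type} [Fintype ι] (v : ι → Fin d → ℝ)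
    {T T' : (Fin d → ℝ) → ι} (hT : IsMLE v T) (hT' : IsEstimator T') :
    ∑ j, isoLaw (v j) {y | T' y = j} ≤ ∑ j, isoLaw (v j) {y | T y = j} := by
  classical
  -- The total success probability integrates the likelihood of the chosen hypothesis, so maximizing
  -- it pointwise is optimal.
  have hsum : ∀ U : (Fin d → ℝ) → ι, IsEstimator U →
      ∑ j, isoLaw (v j) {y | U y = j} =
        ∫⁻ y, likelihoodRatio 1 0 (v (U y)) y ∂isoLaw 0 := by
    intro U hU
    have h : ∀ j, isoLaw (v j) {y | U y = j} =
        ∫⁻ y, {y | U y = j}.indicator (likelihoodRatio 1 0 (v j)) y ∂isoLaw 0 := by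
      intro j
      rw [isoLaw_eq_withDensity, withDensity_apply _ (hU.measurableSet_eq j),
        lintegral_indicator (hU.measurableSet_eq j)]
    simp_rw [h]
    rw [← lintegral_finsetSum _ fun j _ =>
      (measurable_likelihoodRatio _ _ _).indicator (hU.measurableSet_eq j)]
    refine lintegral_congr fun y => ?_
    rw [Finset.sum_eq_single (U y)]
    · exact Set.indicator_of_mem (s := {z | U z = U y}) rfl _
    · intro j _ hj
      exact Set.indicator_of_notMem (s := {z | U z = j}) (fun h => hj h.symm) _
    · simp
  rw [hsum T' hT', hsum T hT.1]
  refine lintegral_mono fun y => ENNReal.ofReal_le_ofReal (Real.exp_le_exp.2 ?_)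
  have hexpand : ∀ j, ∑ i, (((1 : Fin d → ℝ≥0) i : ℝ≥0) : ℝ) *
      (v j i * (y i - (0 : Fin d → ℝ) i) - v j i ^ 2 / 2) =
      (∑ i, y i ^ 2 - ∑ i, (v j i - y i) ^ 2) / 2 := by
    intro j
    rw [← Finset.sum_sub_distrib, Finset.sum_div]
    refine Finset.sum_congr rfl fun i _ => ?_
    simp only [Pi.one_apply, NNReal.coe_one, Pi.zero_apply]
    ring
  rw [hexpand, hexpand]
  linarith [hT.2 y (T' y)]

/-- The event that `S` is not the unique minimizer of the squared distance to `y`. -/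
def ambiguousSet {ι : Type} (v : ι → Fin d → ℝ) (S : ι) : Set (Fin d → ℝ) :=
  {y | ∃ R ≠ S, ∑ i, (v R i - y i) ^ 2 ≤ ∑ i, (v S i - y i) ^ 2}

/-- Ties lie in finitely many hyperplanes, proper ones since `v` is injective, hence null. The error
probability is thus independent of tie-breaking, which need not respect the symmetry. -/
theorem isoLaw_ne_eq_ambiguousSet {ι : Type} [Finite ι] {v : ι → Fin d → ℝ}
    (hv : Function.Injective v) {T : (Fin d → ℝ) → ι} (hT : IsMLE v T) (w : Fin d → ℝ) (S : ι) :
    isoLaw w {y | T y ≠ S} = isoLaw w (ambiguousSet v S) := by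
  refine le_antisymm (measure_mono fun y hy => ⟨T y, hy, hT.2 y S⟩) ?_
  have hnull : isoLaw w (⋃ R : {R // R ≠ S},
      {y | ∑ i, (v S i - v R i) * y i = ∑ i, (v S i ^ 2 - v R i ^ 2) / 2}) = 0 := by
    refine measure_iUnion_null fun R => isoLaw_hyperplane w (v S - v R) ?_ _
    exact sub_ne_zero.2 fun h => R.2 (hv h).symm
  have hsub : ambiguousSet v S ⊆ {y | T y ≠ S} ∪ ⋃ R : {R // R ≠ S},
      {y | ∑ i, (v S i - v R i) * y i = ∑ i, (v S i ^ 2 - v R i ^ 2) / 2} := by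
    rintro y ⟨R, hR, hle⟩
    by_cases hy : T y = S
    · right
      have hge := hT.2 y R
      rw [hy] at hge
      refine Set.mem_iUnion.2 ⟨⟨R, hR⟩, ?_⟩
      have heq := le_antisymm hle hge
      rw [← sub_eq_zero, ← Finset.sum_sub_distrib] at heq
      rw [Set.mem_ofPred_eq, ← sub_eq_zero, ← Finset.sum_sub_distrib]
      have : ∑ i, ((v S i - v R i) * y i - (v S i ^ 2 - v R i ^ 2) / 2) =
          (∑ i, ((v R i - y i) ^ 2 - (v S i - y i) ^ 2)) / 2 := by
        rw [Finset.sum_div]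
        exact Finset.sum_congr rfl fun i _ => by ring
      rw [this, heq, zero_div]
    · exact Or.inl hy
  calc isoLaw w (ambiguousSet v S) ≤ _ := measure_mono hsub
    _ ≤ _ := measure_union_le _ _
    _ = _ := by rw [hnull, add_zero]

theorem isoLaw_ambiguousSet_permKSubset {k : ℕ} (μ : ℝ) (σ : Equiv.Perm (Fin d))
    (S : KSubset d k) :
    isoLaw (kSets d k μ (permKSubset σ S)) (ambiguousSet (kSets d k μ) (permKSubset σ S)) =
      isoLaw (kSets d k μ S) (ambiguousSet (kSets d k μ) S) := by
  have hmp := measurePreserving_arrowCongr' (fun i => gaussianReal (kSets d k μ S i) 1)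
    (fun i => gaussianReal (kSets d k μ (permKSubset σ S) i) 1) σ (MeasurableEquiv.refl ℝ)
    fun i => by rw [kSets_permKSubset]; exact MeasurePreserving.id _
  unfold isoLaw
  rw [← hmp.measure_preimage_equiv]
  congr 1
  ext y
  have hdist : ∀ R : KSubset d k, ∑ i, (kSets d k μ (permKSubset σ R) i - y (σ.symm i)) ^ 2 =
      ∑ i, (kSets d k μ R i - y i) ^ 2 := by
    intro R
    rw [← Equiv.sum_comp σ]
    simp [kSets_permKSubset]
  have hval : ∀ i, MeasurableEquiv.arrowCongr' σ (MeasurableEquiv.refl ℝ) y i = y (σ.symm i) :=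
    fun i => rfl
  simp only [Set.mem_preimage, ambiguousSet, Set.mem_ofPred_eq, hval]
  rw [← (permKSubset σ).exists_congr_right]
  simp only [hdist, ne_eq, EmbeddingLike.apply_eq_iff_eq]

/-- Transitivity of the permutation action makes the risk constant in `S`, so maximum and average
risk agree for the MLE. For any other estimator the maximum is at least the average, which is no
smaller than that of the MLE. -/
theorem maxRisk_isMLE_eq_minimaxRisk {k : ℕ} {μ : ℝ} (hkd : k ≤ d) (hμ : μ ≠ 0)
    {T : (Fin d → ℝ) → KSubset d k} (hT : IsMLE (kSets d k μ) T) :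
    maxRisk (fun S => isoLaw (kSets d k μ S)) T = minimaxRisk (kSets d k μ) := by
  have hne : Nonempty (KSubset d k) := nonempty_kSubset hkd
  refine le_antisymm (le_iInf₂ fun T' hT' => ?_) (iInf₂_le T hT.1)
  set P : KSubset d k → Measure (Fin d → ℝ) := fun S => isoLaw (kSets d k μ S) with hP
  have hconst : ∀ S S', P S {y | T y ≠ S} = P S' {y | T y ≠ S'} := by
    intro S S'
    obtain ⟨σ, rfl⟩ := exists_permKSubset_eq S S'
    simp only [hP, isoLaw_ne_eq_ambiguousSet (kSets_injective hμ) hT,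
      isoLaw_ambiguousSet_permKSubset]
  obtain ⟨S₀⟩ := hne
  have hmax : maxRisk P T = P S₀ {y | T y ≠ S₀} := by
    rw [maxRisk]
    exact le_antisymm (iSup_le fun S => (hconst S S₀).le)
      (le_iSup (fun S => P S {y | T y ≠ S}) S₀)
  have hfin : ∀ U, maxRisk P U ≠ ∞ := fun U =>
    ((maxRisk_le_one P U).trans_lt ENNReal.one_lt_top).ne
  have hcompl : ∀ S, 1 - (P S).real {y | T y = S} = (maxRisk P T).toReal := by
    intro S
    rw [hmax, hconst S₀ S, ← probReal_compl_eq_one_sub (hT.1.measurableSet_eq S)]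
    rfl
  have hbayes : ∑ S, (P S).real {y | T' y = S} ≤ ∑ S, (P S).real {y | T y = S} := by
    have h := ENNReal.toReal_mono (ENNReal.sum_ne_top.2 fun S _ => measure_ne_top _ _)
      (sum_isoLaw_le_of_isMLE (kSets d k μ) hT hT')
    rwa [ENNReal.toReal_sum fun S _ => measure_ne_top _ _,
      ENNReal.toReal_sum fun S _ => measure_ne_top _ _] at h
  rw [← ENNReal.toReal_le_toReal (hfin T) (hfin T')]
  have h1 : ∑ _S : KSubset d k, (maxRisk P T).toReal ≤
      ∑ _S : KSubset d k, (maxRisk P T').toReal := by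
    calc ∑ _S : KSubset d k, (maxRisk P T).toReal
        = ∑ S : KSubset d k, (1 - (P S).real {y | T y = S}) :=
          Finset.sum_congr rfl fun S _ => (hcompl S).symm
      _ ≤ ∑ S : KSubset d k, (1 - (P S).real {y | T' y = S}) := by
          rw [Finset.sum_sub_distrib, Finset.sum_sub_distrib]
          linarith
      _ ≤ _ := Finset.sum_le_sum fun S _ => one_sub_le_maxRisk_real P hT' S
  simp only [Finset.sum_const, nsmul_eq_mul] at h1
  have hcard : (0 : ℝ) < (Finset.univ : Finset (KSubset d k)).card := by
    exact_mod_cast Finset.card_pos.2 ⟨S₀, Finset.mem_univ _⟩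
  exact le_of_mul_le_mul_left h1 hcard

end ExactOptimality

end NormalMeans

theorem corollary1 :
    -- the minimax rates, isotropic and with budget `τ`
    (∀ d k : ℕ → ℕ, Tendsto d atTop atTop → (∀ n, 1 ≤ k n) → (∀ n, k n < d n) →
      NormalMeans.IsMinimaxRate
        (fun n μ => NormalMeans.minimaxRisk (NormalMeans.kSets (d n) (k n) μ))
        (fun n => √(Real.log ((k n : ℝ) * ((d n : ℝ) - (k n : ℝ))))) ∧
      ∀ τ : ℕ → ℝ≥0, (∀ n, 0 < τ n) →
        NormalMeans.IsMinimaxRate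
          (fun n μ => NormalMeans.budgetMinimaxRisk (NormalMeans.kSets (d n) (k n) μ) (τ n))
          (fun n => √((d n : ℝ) / (τ n : ℝ) *
            Real.log ((k n : ℝ) * ((d n : ℝ) - (k n : ℝ))))) ∧
        -- uniform sampling, with the MLE, attains the rate
        (∀ (μ : ℕ → ℝ) (T : ∀ n, (Fin (d n) → ℝ) → NormalMeans.KSubset (d n) (k n)),
          (fun n => √((d n : ℝ) / (τ n : ℝ) *
            Real.log ((k n : ℝ) * ((d n : ℝ) - (k n : ℝ))))) =o[atTop] μ →
          (∀ n, NormalMeans.IsDesignMLE (NormalMeans.kSets (d n) (k n) (μ n))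
            (NormalMeans.uniformDesign (d n) (τ n)) (T n)) →
          Tendsto (fun n => NormalMeans.maxRisk
            (fun S => NormalMeans.designLaw (NormalMeans.kSets (d n) (k n) (μ n) S)
              (NormalMeans.uniformDesign (d n) (τ n))) (T n)) atTop (𝓝 0))) ∧
    -- uniform sampling minimizes the SEDF under the budget constraint
    (∀ (d k : ℕ) (μ α : ℝ) (τ : ℝ≥0), k ≤ d → 0 < α →
      ∑ i, NormalMeans.uniformDesign d τ i ≤ τ ∧
      ∀ B : Fin d → ℝ≥0, ∑ i, B i ≤ τ →
        NormalMeans.sedf (NormalMeans.kSets d k μ) α (NormalMeans.uniformDesign d τ) ≤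
          NormalMeans.sedf (NormalMeans.kSets d k μ) α B) ∧
    -- maximum likelihood estimators exist, for every sampling strategy
    (∀ (d k : ℕ) (μ : ℝ), k ≤ d →
      (∃ T, NormalMeans.IsMLE (NormalMeans.kSets d k μ) T) ∧
      ∀ B : Fin d → ℝ≥0, ∃ T, NormalMeans.IsDesignMLE (NormalMeans.kSets d k μ) B T) ∧
    -- in the isotropic case the MLE is exactly minimax optimal
    (∀ (d k : ℕ) (μ : ℝ), k ≤ d → μ ≠ 0 →
      ∀ T, NormalMeans.IsMLE (NormalMeans.kSets d k μ) T →
        NormalMeans.maxRisk (fun S => NormalMeans.isoLaw (NormalMeans.kSets d k μ S)) T =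
          NormalMeans.minimaxRisk (NormalMeans.kSets d k μ)) := by
  refine ⟨fun d k hd hk hkd => ⟨NormalMeans.isMinimaxRate_isotropic hd hk hkd, fun τ hτ =>
    ⟨NormalMeans.isMinimaxRate_budget hd hk hkd hτ, fun μ T h hT =>
      NormalMeans.tendsto_maxRisk_uniformDesign hd hk hkd hτ h hT⟩⟩, ?_, ?_, ?_⟩
  · exact fun d k μ α τ hkd hα => ⟨NormalMeans.sum_uniformDesign_le d τ,
      fun B hB => NormalMeans.sedf_uniformDesign_le hkd μ hα hB⟩
  · intro d k μ hkd
    have : Nonempty (NormalMeans.KSubset d k) := NormalMeans.nonempty_kSubset hkd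
    obtain ⟨T, hT⟩ := NormalMeans.exists_isDesignMLE (NormalMeans.kSets d k μ) 1
    exact ⟨⟨T, (NormalMeans.isMLE_iff_isDesignMLE_one _ T).2 hT⟩,
      NormalMeans.exists_isDesignMLE _⟩
  · exact fun d k μ hkd hμ T hT => NormalMeans.maxRisk_isMLE_eq_minimaxRisk hkd hμ hT
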